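/- Let $G$ be a complex Banach space and $B(G)$ the algebra of bounded operators on $G$. A countably additive spectral measure is a map $E$ from the Borel subsets of $\mathbb C$ to the projectors in $B(G)$ with $E(\mathbb C)=1$, $E(\emptyset)=0$, $E(\sigma\cap\delta)=E(\sigma)E(\delta)$, $E(\sigma\cup\delta)=E(\sigma)+E(\delta)-E(\sigma)E(\delta)$, such that $\sigma\mapsto\phi(E(\sigma)x)$ is countably additive for all $x\in G$, $\phi\in G^*$. Its support is $S=\bigcap\{\overline\sigma : \sigma \text{ Borel},\ E(\sigma)=1\}$. For a Borel function $f:S\to\mathbb C$ let $f_n:\mathbb C\to\mathbb C$ be equal to $f$ on $\{\lambda\in S:|f(\lambda)|\le n\}$ and $0$ elsewhere; $f(E)$ is the operator $f(E)x=\lim_{n}\left(\int f_n\,dE\right)x$ whose domain is the set of all $x\in G$ for which the limit exists in $G$, where the integral of a bounded Borel function is the operator-norm limit of the integrals of uniformly approximating Borel simple functions. A linear operator $R$ in $G$ is called scalar type spectral if $R=\imath(E)$ for some such $E$, with $\imath(\lambda)=\lambda$; then $E$ is unique, its support is the spectrum $\sigma(R)$, and for every function $f$ that is defined at least on $\sigma(R)$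 and Borel there, $f(R):=f(E)$ (only the restriction of $f$ to $\sigma(R)$ matters). **Theorem.** Let $T\in B(G)$ be a scalar type spectral operator, $0<L\le\infty$, $U\subseteq\mathbb C$ an open set with $\sigma(T)\subseteq U$ and $t\lambda\in U$ for all $t\in\,]-L,L[$ and $\lambda\in U$, and let $F:U\to\mathbb C$ be analytic, with derivative $F'$. For $t\in\,]-L,L[$ put $F_t(\lambda)=F(t\lambda)$, $\lambda\in U$. Then for every $t\in\,]-L,L[$ the operator $tT$ is scalar type spectral with $\sigma(tT)\subseteq U$, the operators $F(tT)$ and $F'(tT)$ (formed by the functional calculus of $tT$) and $F_t(T)$ (formed by that of $T$) belong to $B(G)$, and: 1. $F(tT)=F_t(T)$ for all $t\in\,]-L,L[$; 2. the map $t\mapsto F(tT)\in B(G)$ is differentiable on $]-L,L[$ in the operator norm, and $\dfrac{d}{dt}F(tT)=T\,F'(tT)$; 3. for all $u_1,u_2\in\,]-L,L[$ the map $t\mapsto F'(tT)$ is Bochner integrable in $B(G)$ with the operator norm between $u_1$ and $u_2$, and $$T\int_{u_1}^{u_2}F'(tT)\,dt=F(u_2T)-F(u_1T).$$ -/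

import Mathlib

open Filter Topology MeasureTheory

/-- A countably additive spectral measure in `G` on the Borel subsets of `ℂ`: a map with values in
the projectors of `G`, multiplicative on intersections, normalized, and countably additive for the
weak operator topology. Only the values on Borel sets are constrained (and used). -/
structure IsSpectralMeasure {G : Type*} [NormedAddCommGroup G] [NormedSpace ℂ G]
    (E : Set ℂ → (G →L[ℂ] G)) : Prop where
  proj : ∀ s, MeasurableSet s → E s * E s = E s
  inter : ∀ s t, MeasurableSet s → MeasurableSet t → E (s ∩ t) = E s * E t
  union : ∀ s t, MeasurableSet s → MeasurableSet t → E (s ∪ t) = E s + E t - E s * E t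
  univ : E Set.univ = 1
  empty : E ∅ = 0
  weak_countably_additive : ∀ s : ℕ → Set ℂ, (∀ n, MeasurableSet (s n)) →
    Pairwise (fun m n => Disjoint (s m) (s n)) → ∀ (x : G) (φ : StrongDual ℂ G),
      HasSum (fun n => φ (E (s n) x)) (φ (E (⋃ n, s n) x))

namespace SpectralMeasure

variable {G : Type*} [NormedAddCommGroup G] [NormedSpace ℂ G]

/-- The support: the intersection of the closures of all Borel sets `s` with `E s = 1`. -/
def supp (E : Set ℂ → (G →L[ℂ] G)) : Set ℂ :=
  ⋂ s ∈ {s : Set ℂ | MeasurableSet s ∧ E s = 1}, closure s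

/-- The integral `∑ c, c • E (s = c)` of a Borel simple function. -/
noncomputable def simpleIntegral (E : Set ℂ → (G →L[ℂ] G)) (s : SimpleFunc ℂ ℂ) : G →L[ℂ] G :=
  ∑ c ∈ s.range, c • E (s ⁻¹' {c})

/-- `A` is the integral of `f` with respect to `E`: the limit in operator norm of the integrals of
Borel simple functions that converge to `f` uniformly on `ℂ`. -/
def HasSpectralIntegral (E : Set ℂ → (G →L[ℂ] G)) (f : ℂ → ℂ) (A : G →L[ℂ] G) : Prop :=
  ∃ s : ℕ → SimpleFunc ℂ ℂ, TendstoUniformly (fun n z => s n z) f atTop ∧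
    Tendsto (fun n => simpleIntegral E (s n)) atTop (𝓝 A)

open Classical in
/-- The integral of a totally measurable (for instance a bounded Borel) function `f : ℂ → ℂ`;
it is `0` if the integral does not exist. -/
noncomputable def spectralIntegral (E : Set ℂ → (G →L[ℂ] G)) (f : ℂ → ℂ) : G →L[ℂ] G :=
  if h : ∃ A, HasSpectralIntegral E f A then h.choose else 0

/-- The truncation `f_n`: equal to `f` on the points of the support of `E` at which `|f| ≤ n`,
and `0` elsewhere. -/
noncomputable def trunc (E : Set ℂ → (G →L[ℂ] G)) (f : ℂ → ℂ) (n : ℕ) : ℂ → ℂ :=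
  Set.indicator (supp E ∩ {z | ‖f z‖ ≤ n}) f

/-- The Borel functional calculus of a spectral measure: `f(E)` is the (possibly unbounded)
operator `x ↦ lim_n (∫ f_n dE) x`, whose domain is the set of all `x` for which the limit exists.
Only the restriction of `f` to the support of `E` matters. -/
noncomputable def calculus (E : Set ℂ → (G →L[ℂ] G)) (f : ℂ → ℂ) : G →ₗ.[ℂ] G where
  domain :=
    { carrier := {x | ∃ y, Tendsto (fun n => spectralIntegral E (trunc E f n) x) atTop (𝓝 y)}
      zero_mem' := ⟨0, by simp⟩
      add_mem' := by
        rintro x x' ⟨y, hy⟩ ⟨y', hy'⟩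
        exact ⟨y + y', by simpa using hy.add hy'⟩
      smul_mem' := by
        rintro c x ⟨y, hy⟩
        exact ⟨c • y, by simpa using hy.const_smul c⟩ }
  toFun :=
    { toFun := fun x => x.2.choose
      map_add' := by
        intro x x'
        refine tendsto_nhds_unique (x + x').2.choose_spec ?_
        simpa using x.2.choose_spec.add x'.2.choose_spec
      map_smul' := by
        intro c x
        refine tendsto_nhds_unique (c • x).2.choose_spec ?_
        simpa using x.2.choose_spec.const_smul c }

/-- `E` is a resolution of the identity of the scalar type spectral operator `R`: `E` is a countably
additive spectral measure and `R = ι(E)`, where `ι` is the identity function. -/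
def IsResolution (R : G →ₗ.[ℂ] G) (E : Set ℂ → (G →L[ℂ] G)) : Prop :=
  IsSpectralMeasure E ∧ R = calculus E (fun z => z)

end SpectralMeasure

/-- A bounded operator, regarded as a linear operator in `G` whose domain is all of `G`. -/
def ContinuousLinearMap.everywhere {G : Type*} [NormedAddCommGroup G] [NormedSpace ℂ G]
    (T : G →L[ℂ] G) : G →ₗ.[ℂ] G :=
  (T : G →ₗ[ℂ] G).toPMap ⊤

/-- A (possibly unbounded) scalar type spectral operator in `G`. -/
def IsScalarTypeSpectral {G : Type*} [NormedAddCommGroup G] [NormedSpace ℂ G]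
    (R : G →ₗ.[ℂ] G) : Prop :=
  ∃ E : Set ℂ → (G →L[ℂ] G), SpectralMeasure.IsResolution R E

open Classical in
/-- The Borel functional calculus `f(R) = f(E)` of a scalar type spectral operator `R`, where `E` is
its resolution of the identity (which is unique on Borel sets). The value for an `R` that is not
scalar type spectral is a dummy. -/
noncomputable def borelCalculus {G : Type*} [NormedAddCommGroup G] [NormedSpace ℂ G]
    (R : G →ₗ.[ℂ] G) (f : ℂ → ℂ) : G →ₗ.[ℂ] G :=
  if h : IsScalarTypeSpectral R then SpectralMeasure.calculus h.choose f else ⊥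

/-! Write K for the spectrum of T. A spectral measure E is uniformly bounded by some M
(`exists_bound`), so `∫ f dE` is multiplicative in f and bounded by `4 * M * sup ‖f‖`. Since the
support of E lies in K (`supp_subset_spectrum`), integration gives a bounded algebra homomorphism A
from `C(K, ℂ)` to `B(G)` that sends the identity function to T (`continuousCalculus_id`).

The image of E under `z ↦ t * z` resolves the identity of tT (`IsResolution.smul`), hence F(tT) =
A(F(t·)) and F'(tT) = A(F'(t·)) by change of variables (`calculus_preimage`). In `C(K, ℂ)` the map t
↦ F'(t·) is norm continuous, and the scalar fundamental theorem of calculus at each z gives `∫ id *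
F'(t·) dt = F(u₂·) - F(u₁·)` (`integral_dilation_deriv`). Applying A, which commutes with the
integral and turns multiplication by id into multiplication by T, yields the integral formula; the
derivative formula follows because the integrand is continuous.

Full uniqueness of E is not needed: all functions involved are continuous on the spectrum, where two
resolutions give the same calculus (`IsResolution.calculus_eq`), by Stone–Weierstrass and a
Fuglede–Rosenblum argument (`algHom_star_eq`). -/

/-! ### Algebra and uniform boundedness of spectral measures -/

namespace IsSpectralMeasure

variable {G : Type*} [NormedAddCommGroup G] [NormedSpace ℂ G] {E : Set ℂ → (G →L[ℂ] G)}

theorem union_of_disjoint (hE : IsSpectralMeasure E) {s t : Set ℂ} (hs : MeasurableSet s)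
    (ht : MeasurableSet t) (hd : Disjoint s t) : E (s ∪ t) = E s + E t := by
  rw [hE.union s t hs ht, ← hE.inter s t hs ht, hd.inter_eq, hE.empty, sub_zero]

theorem biUnion_finset (hE : IsSpectralMeasure E) {ι : Type*} (S : Finset ι) (s : ι → Set ℂ)
    (hs : ∀ i, MeasurableSet (s i)) (hd : Pairwise (fun i j => Disjoint (s i) (s j))) :
    E (⋃ i ∈ S, s i) = ∑ i ∈ S, E (s i) := by
  classical
  induction S using Finset.induction_on with
  | empty => simp [hE.empty]
  | insert a S ha ih =>
    rw [Finset.set_biUnion_insert, hE.union_of_disjoint (hs a)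
      (Finset.measurableSet_biUnion S fun i _ => hs i), ih, Finset.sum_insert ha]
    rw [Set.disjoint_iUnion₂_right]
    intro i hi
    exact hd (by rintro rfl; exact ha hi)

theorem compl (hE : IsSpectralMeasure E) {s : Set ℂ} (hs : MeasurableSet s) :
    E sᶜ = 1 - E s := by
  have h := hE.union_of_disjoint hs hs.compl disjoint_compl_right
  rw [Set.union_compl_self, hE.univ] at h
  rw [h, add_sub_cancel_left]

theorem compl_eq_zero (hE : IsSpectralMeasure E) {s : Set ℂ} (hs : MeasurableSet s)
    (h : E s = 1) : E sᶜ = 0 := by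
  rw [hE.compl hs, h, sub_self]

theorem eq_one_of_compl_eq_zero (hE : IsSpectralMeasure E) {s : Set ℂ} (hs : MeasurableSet s)
    (h : E sᶜ = 0) : E s = 1 := by
  rw [hE.compl hs] at h
  exact (sub_eq_zero.mp h).symm

theorem eq_one_of_subset (hE : IsSpectralMeasure E) {s t : Set ℂ} (hs : MeasurableSet s)
    (ht : MeasurableSet t) (hst : s ⊆ t) (h : E s = 1) : E t = 1 := by
  have := hE.inter s t hs ht
  rwa [Set.inter_eq_left.mpr hst, h, one_mul, eq_comm] at this

theorem eq_zero_of_subset (hE : IsSpectralMeasure E) {s t : Set ℂ} (hs : MeasurableSet s)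
    (ht : MeasurableSet t) (hst : s ⊆ t) (h : E t = 0) : E s = 0 := by
  have := hE.inter s t hs ht
  rwa [Set.inter_eq_left.mpr hst, h, mul_zero] at this

theorem iUnion_eq_zero (hE : IsSpectralMeasure E) {s : ℕ → Set ℂ} (hs : ∀ n, MeasurableSet (s n))
    (h : ∀ n, E (s n) = 0) : E (⋃ n, s n) = 0 := by
  have hdm : ∀ n, MeasurableSet (disjointed s n) := fun n => .disjointed hs n
  have hz : ∀ n, E (disjointed s n) = 0 := fun n =>
    hE.eq_zero_of_subset (hdm n) (hs n) (disjointed_subset s n) (h n)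
  ext x
  refine (SeparatingDual.eq_iff_forall_dual_eq (R := ℂ)).mpr fun φ => ?_
  have h1 := hE.weak_countably_additive _ hdm (disjoint_disjointed s) x φ
  simp only [hz, iUnion_disjointed] at h1
  simpa using h1.unique (by simp)

/-- The complex measure `s ↦ φ (E s x)`. -/
noncomputable def scalarMeasure (hE : IsSpectralMeasure E) (x : G) (φ : StrongDual ℂ G) :
    VectorMeasure ℂ ℂ := by
  classical
  exact
  { measureOf' := fun s => if MeasurableSet s then φ (E s x) else 0
    empty' := by simp [hE.empty]
    not_measurable' := fun s hs => by simp [hs]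
    m_iUnion' := fun s hs hd => by
      simp only [hs, MeasurableSet.iUnion hs, if_true]
      exact hE.weak_countably_additive s hs hd x φ }

theorem scalarMeasure_apply (hE : IsSpectralMeasure E) (x : G) (φ : StrongDual ℂ G) {s : Set ℂ}
    (hs : MeasurableSet s) : hE.scalarMeasure x φ s = φ (E s x) :=
  if_pos hs

/-- A countably additive spectral measure is uniformly bounded. -/
theorem exists_bound [CompleteSpace G] (hE : IsSpectralMeasure E) :
    ∃ M : ℝ, 0 ≤ M ∧ ∀ s, MeasurableSet s → ‖E s‖ ≤ M := by
  have h1 : ∀ x : G, ∃ C, ∀ s : {s : Set ℂ // MeasurableSet s}, ‖E s x‖ ≤ C := by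
    intro x
    -- For fixed x and φ a complex measure is bounded. Uniform boundedness is applied twice: here on
    -- the dual, with the vectors `E s x` viewed isometrically in the bidual, and then on G itself.
    obtain ⟨C, hC⟩ := banach_steinhaus
      (g := fun s : {s : Set ℂ // MeasurableSet s} =>
        NormedSpace.inclusionInDoubleDual ℂ G (E s x)) fun φ =>
      ⟨(hE.scalarMeasure x φ).bound, fun s => by
        have := (hE.scalarMeasure x φ).norm_apply_le_bound (s := s.1)
        rwa [hE.scalarMeasure_apply x φ s.2] at this⟩
    refine ⟨C, fun s => ?_⟩
    have := hC s
    rwa [← (NormedSpace.inclusionInDoubleDualLi (E := G) ℂ).norm_map]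
  obtain ⟨C, hC⟩ := banach_steinhaus h1
  exact ⟨C, (norm_nonneg _).trans (hC ⟨∅, .empty⟩), fun s hs => hC ⟨s, hs⟩⟩

end IsSpectralMeasure

/-! ### Integrals of simple functions -/

/-- If all the subset sums of a finite family of real numbers are bounded by `M`, then the family
is absolutely bounded by `2 * M`. -/
theorem Finset.sum_abs_le_of_subset_sum_le {ι : Type*} (S : Finset ι) (a : ι → ℝ) {M : ℝ}
    (h : ∀ S' ⊆ S, |∑ i ∈ S', a i| ≤ M) : ∑ i ∈ S, |a i| ≤ 2 * M := by
  classical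
  rw [← Finset.sum_filter_add_sum_filter_not S (fun i => 0 ≤ a i)]
  have h1 := h _ (Finset.filter_subset (fun i => 0 ≤ a i) S)
  have h2 := h _ (Finset.filter_subset (fun i => ¬ 0 ≤ a i) S)
  rw [Finset.sum_congr rfl fun i hi => abs_of_nonneg (Finset.mem_filter.mp hi).2,
    Finset.sum_congr rfl fun i hi => abs_of_neg (not_le.mp (Finset.mem_filter.mp hi).2),
    Finset.sum_neg_distrib]
  linarith [le_abs_self (∑ i ∈ S with 0 ≤ a i, a i), neg_abs_le (∑ i ∈ S with ¬ 0 ≤ a i, a i)]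

theorem Finset.sum_norm_le_of_subset_sum_le {ι : Type*} (S : Finset ι) (a : ι → ℂ) {M : ℝ}
    (h : ∀ S' ⊆ S, ‖∑ i ∈ S', a i‖ ≤ M) : ∑ i ∈ S, ‖a i‖ ≤ 4 * M := by
  have hre := S.sum_abs_le_of_subset_sum_le (fun i => (a i).re) fun S' hS' => by
    simpa using (Complex.abs_re_le_norm _).trans (h S' hS')
  have him := S.sum_abs_le_of_subset_sum_le (fun i => (a i).im) fun S' hS' => by
    simpa using (Complex.abs_im_le_norm _).trans (h S' hS')
  have := Finset.sum_le_sum fun i (_ : i ∈ S) => Complex.norm_le_abs_re_add_abs_im (a i)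
  rw [Finset.sum_add_distrib] at this
  linarith

namespace SpectralMeasure

variable {G : Type*} [NormedAddCommGroup G] [NormedSpace ℂ G] {E : Set ℂ → (G →L[ℂ] G)}

theorem disjoint_fibers {α β : Type*} (g : α → β) :
    Pairwise (fun i j => Disjoint (g ⁻¹' {i}) (g ⁻¹' {j})) := fun _ _ hij =>
  Disjoint.preimage _ (by simpa using hij)

/-- Two simple functions s, t are both images of `s.pair t`, so sums and products can be computed
over one common partition. Allowing S larger than the range lets S be a product of the two ranges.
-/
theorem simpleIntegral_map (hE : IsSpectralMeasure E) {α : Type*} (g : SimpleFunc ℂ α)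
    (h : α → ℂ) {S : Finset α} (hS : g.range ⊆ S) :
    simpleIntegral E (g.map h) = ∑ a ∈ S, h a • E (g ⁻¹' {a}) := by
  classical
  have h0 : ∑ a ∈ S, h a • E (g ⁻¹' {a}) = ∑ a ∈ g.range, h a • E (g ⁻¹' {a}) := by
    refine (Finset.sum_subset hS fun a _ ha => ?_).symm
    rw [SimpleFunc.preimage_eq_empty_iff g a |>.mpr ha, hE.empty, smul_zero]
  rw [h0, simpleIntegral, SimpleFunc.range_map,
    ← Finset.sum_fiberwise_of_maps_to (fun a ha => Finset.mem_image_of_mem h ha)]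
  refine Finset.sum_congr rfl fun c _ => ?_
  have h1 : (g.map h) ⁻¹' {c} = ⋃ a ∈ g.range.filter (fun a => h a = c), g ⁻¹' {a} := by
    ext z
    simp
  rw [h1, hE.biUnion_finset _ _ (fun a => g.measurableSet_fiber a) (disjoint_fibers g),
    Finset.smul_sum]
  exact Finset.sum_congr rfl fun a ha => by rw [(Finset.mem_filter.mp ha).2]

theorem simpleIntegral_add (hE : IsSpectralMeasure E) (s t : SimpleFunc ℂ ℂ) :
    simpleIntegral E (s + t) = simpleIntegral E s + simpleIntegral E t := by
  have h1 := simpleIntegral_map hE (s.pair t) Prod.fst subset_rfl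
  have h2 := simpleIntegral_map hE (s.pair t) Prod.snd subset_rfl
  have h3 := simpleIntegral_map hE (s.pair t) (fun p => p.1 + p.2) subset_rfl
  rw [SimpleFunc.map_fst_pair] at h1
  rw [SimpleFunc.map_snd_pair] at h2
  rw [SimpleFunc.add_eq_map₂, h1, h2, h3, ← Finset.sum_add_distrib]
  simp only [add_smul]

theorem simpleIntegral_mul (hE : IsSpectralMeasure E) (s t : SimpleFunc ℂ ℂ) :
    simpleIntegral E (s * t) = simpleIntegral E s * simpleIntegral E t := by
  have hS : (s.pair t).range ⊆ s.range ×ˢ t.range := by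
    intro p hp
    obtain ⟨z, rfl⟩ := SimpleFunc.mem_range.mp hp
    simp
  rw [SimpleFunc.mul_eq_map₂, simpleIntegral_map hE _ _ hS, simpleIntegral, simpleIntegral,
    Finset.sum_mul_sum, Finset.sum_product]
  refine Finset.sum_congr rfl fun a _ => Finset.sum_congr rfl fun b _ => ?_
  have : (s.pair t) ⁻¹' {(a, b)} = s ⁻¹' {a} ∩ t ⁻¹' {b} := by
    rw [← SimpleFunc.pair_preimage, Set.singleton_prod_singleton]
  rw [this, hE.inter _ _ (s.measurableSet_fiber a) (t.measurableSet_fiber b), smul_mul_smul_comm]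

theorem simpleIntegral_const (hE : IsSpectralMeasure E) (c : ℂ) :
    simpleIntegral E (SimpleFunc.const ℂ c) = c • 1 := by
  rw [simpleIntegral, SimpleFunc.range_const]
  have : SimpleFunc.const ℂ c ⁻¹' {c} = Set.univ := by
    ext z
    simp
  rw [Finset.sum_singleton, this, hE.univ]

theorem simpleIntegral_indicator (hE : IsSpectralMeasure E) {s : Set ℂ} (hs : MeasurableSet s) :
    simpleIntegral E (SimpleFunc.piecewise s hs (SimpleFunc.const ℂ 1) (SimpleFunc.const ℂ 0))
      = E s := by
  classical
  have h := simpleIntegral_map hE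
    (SimpleFunc.piecewise s hs (SimpleFunc.const ℂ (1 : ℂ)) (SimpleFunc.const ℂ 0)) id
    (S := {1, 0}) (by
      intro a ha
      obtain ⟨z, rfl⟩ := SimpleFunc.mem_range.mp ha
      by_cases hz : z ∈ s <;> simp [hz])
  have hid : ∀ g : SimpleFunc ℂ ℂ, g.map id = g := fun g => SimpleFunc.ext fun _ => rfl
  rw [hid] at h
  rw [h, Finset.sum_pair one_ne_zero]
  simp only [id, one_smul, zero_smul, add_zero]
  congr 1
  ext z
  by_cases hz : z ∈ s <;> simp [hz]

/-- By finite additivity, a subset sum of the numbers `φ (E (s ⁻¹' {c}) x)` is the value at a union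
of fibers, bounded by `M * ‖x‖ * ‖φ‖`. The sum of their norms is then at most four times this,
whence the factor 4. -/
theorem norm_simpleIntegral_le (hE : IsSpectralMeasure E) {M : ℝ} (hM0 : 0 ≤ M)
    (hM : ∀ s, MeasurableSet s → ‖E s‖ ≤ M) (s : SimpleFunc ℂ ℂ) {C : ℝ} (hC0 : 0 ≤ C)
    (hC : ∀ z, ‖s z‖ ≤ C) : ‖simpleIntegral E s‖ ≤ 4 * M * C := by
  refine ContinuousLinearMap.opNorm_le_bound _ (by positivity) fun x => ?_
  refine NormedSpace.norm_le_dual_bound ℂ _ (by positivity) fun φ => ?_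
  have hsum : ∑ c ∈ s.range, ‖φ (E (s ⁻¹' {c}) x)‖ ≤ 4 * (M * ‖x‖ * ‖φ‖) := by
    refine Finset.sum_norm_le_of_subset_sum_le _ _ fun S' _ => ?_
    have h1 : ∑ c ∈ S', φ (E (s ⁻¹' {c}) x) = φ (E (⋃ c ∈ S', s ⁻¹' {c}) x) := by
      rw [hE.biUnion_finset S' _ (fun a => s.measurableSet_fiber a) (disjoint_fibers s)]
      simp
    rw [h1]
    have h2 := hM (⋃ c ∈ S', s ⁻¹' {c})
      (Finset.measurableSet_biUnion S' fun c _ => s.measurableSet_fiber c)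
    calc _ ≤ ‖φ‖ * (‖E (⋃ c ∈ S', s ⁻¹' {c})‖ * ‖x‖) :=
          (φ.le_opNorm _).trans (by gcongr; exact ContinuousLinearMap.le_opNorm _ _)
      _ ≤ ‖φ‖ * (M * ‖x‖) := by gcongr
      _ = _ := by ring
  have h3 : φ (simpleIntegral E s x) = ∑ c ∈ s.range, c * φ (E (s ⁻¹' {c}) x) := by
    simp [simpleIntegral]
  rw [h3]
  calc _ ≤ ∑ c ∈ s.range, C * ‖φ (E (s ⁻¹' {c}) x)‖ := by
        refine (norm_sum_le _ _).trans (Finset.sum_le_sum fun c hc => ?_)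
        obtain ⟨z, rfl⟩ := SimpleFunc.mem_range.mp hc
        rw [norm_mul]
        gcongr
        exact hC z
    _ = C * ∑ c ∈ s.range, ‖φ (E (s ⁻¹' {c}) x)‖ := by rw [Finset.mul_sum]
    _ ≤ C * (4 * (M * ‖x‖ * ‖φ‖)) := by gcongr
    _ = _ := by ring

end SpectralMeasure

/-! ### Integrals of bounded Borel functions -/

theorem MeasureTheory.SimpleFunc.exists_dist_lt {f : ℂ → ℂ} (hf : Measurable f) {C : ℝ}
    (hC : ∀ z, ‖f z‖ ≤ C) {ε : ℝ} (hε : 0 < ε) : ∃ s : SimpleFunc ℂ ℂ, ∀ z, dist (s z) (f z) < ε := by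
  obtain ⟨I, hI⟩ := (isCompact_closedBall (0 : ℂ) C).elim_finite_subcover
    (fun k : ℕ => Metric.ball (TopologicalSpace.denseSeq ℂ k) ε) (fun _ => Metric.isOpen_ball)
    (fun z _ => by
      obtain ⟨k, hk⟩ := (TopologicalSpace.denseRange_denseSeq ℂ).exists_dist_lt z hε
      exact Set.mem_iUnion.mpr ⟨k, hk⟩)
  -- By compactness finitely many terms of the dense sequence form an ε-net of the disc containing
  -- the values of f; each value is moved to a nearest term.
  refine ⟨(SimpleFunc.nearestPt (TopologicalSpace.denseSeq ℂ) (I.sup id)).comp f hf, fun z => ?_⟩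
  obtain ⟨k, hkI, hk⟩ := Set.mem_iUnion₂.mp (hI (mem_closedBall_zero_iff.mpr (hC z)))
  have h1 := SimpleFunc.edist_nearestPt_le (TopologicalSpace.denseSeq ℂ) (f z)
    (Finset.le_sup (f := id) hkI)
  rw [edist_dist, edist_dist, ENNReal.ofReal_le_ofReal_iff dist_nonneg] at h1
  rw [SimpleFunc.coe_comp]
  exact h1.trans_lt (by rw [dist_comm]; exact hk)

theorem TendstoUniformly.mul_of_bounded {α ι : Type*} {l : Filter ι} {s t : ι → α → ℂ}
    {f g : α → ℂ} (hs : TendstoUniformly s f l) (ht : TendstoUniformly t g l) {C : ℝ} (hC0 : 0 ≤ C)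
    (hf : ∀ x, ‖f x‖ ≤ C) (hg : ∀ x, ‖g x‖ ≤ C) :
    TendstoUniformly (fun n x => s n x * t n x) (fun x => f x * g x) l := by
  rw [Metric.tendstoUniformly_iff] at hs ht ⊢
  intro ε hε
  have hδ : 0 < min 1 (ε / (2 * C + 2)) := lt_min one_pos (by positivity)
  filter_upwards [hs _ hδ, ht _ hδ] with n hn hm x
  have h1 := hn x
  have h2 := hm x
  rw [dist_eq_norm] at h1 h2 ⊢
  set δ := min 1 (ε / (2 * C + 2))
  have hδ1 : δ ≤ 1 := min_le_left _ _
  have hδ2 : δ * (2 * C + 2) ≤ ε := by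
    rw [← le_div_iff₀ (by positivity)]; exact min_le_right _ _
  have h3 : ‖t n x‖ ≤ C + 1 := by
    calc ‖t n x‖ = ‖g x - (g x - t n x)‖ := by rw [sub_sub_cancel]
      _ ≤ ‖g x‖ + ‖g x - t n x‖ := norm_sub_le _ _
      _ ≤ C + 1 := add_le_add (hg x) (h2.le.trans hδ1)
  calc ‖f x * g x - s n x * t n x‖ = ‖f x * (g x - t n x) + (f x - s n x) * t n x‖ := by
        congr 1; ring
    _ ≤ ‖f x‖ * ‖g x - t n x‖ + ‖f x - s n x‖ * ‖t n x‖ := by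
        rw [← norm_mul, ← norm_mul]; exact norm_add_le _ _
    _ ≤ C * δ + δ * (C + 1) := by
        gcongr
        exact hf x
    _ < δ * (2 * C + 2) := by nlinarith
    _ ≤ ε := hδ2

namespace SpectralMeasure

variable {G : Type*} [NormedAddCommGroup G] [NormedSpace ℂ G] {E : Set ℂ → (G →L[ℂ] G)}
  {f g : ℂ → ℂ} {A B : G →L[ℂ] G}

theorem HasSpectralIntegral.of_simpleFunc (s : SimpleFunc ℂ ℂ) :
    HasSpectralIntegral E s (simpleIntegral E s) :=
  ⟨fun _ => s, fun _ hu => .of_forall fun _ _ => refl_mem_uniformity hu, tendsto_const_nhds⟩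

theorem HasSpectralIntegral.const (hE : IsSpectralMeasure E) (c : ℂ) :
    HasSpectralIntegral E (fun _ => c) (c • 1) := by
  have h := HasSpectralIntegral.of_simpleFunc (E := E) (SimpleFunc.const ℂ c)
  rwa [simpleIntegral_const hE] at h

theorem HasSpectralIntegral.indicator_one (hE : IsSpectralMeasure E) {s : Set ℂ}
    (hs : MeasurableSet s) : HasSpectralIntegral E (s.indicator fun _ => 1) (E s) := by
  have h := HasSpectralIntegral.of_simpleFunc (E := E)
    (SimpleFunc.piecewise s hs (SimpleFunc.const ℂ 1) (SimpleFunc.const ℂ 0))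
  rw [simpleIntegral_indicator hE hs] at h
  convert h using 1
  ext z
  by_cases hz : z ∈ s <;> simp [hz]

theorem HasSpectralIntegral.exists_norm_le (h : HasSpectralIntegral E f A) :
    ∃ C, 0 ≤ C ∧ ∀ z, ‖f z‖ ≤ C := by
  obtain ⟨s, hs, -⟩ := h
  obtain ⟨n, hn⟩ := (Metric.tendstoUniformly_iff.mp hs 1 one_pos).exists
  obtain ⟨C, hC⟩ := (s n).exists_forall_norm_le
  have hb : ∀ z, ‖f z‖ ≤ C + 1 := fun z => by
    have h1 := hn z
    rw [dist_eq_norm] at h1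
    calc ‖f z‖ = ‖(f z - s n z) + s n z‖ := by rw [sub_add_cancel]
      _ ≤ _ := norm_add_le _ _
      _ ≤ C + 1 := by linarith [hC z]
  exact ⟨C + 1, (norm_nonneg _).trans (hb 0), hb⟩

theorem HasSpectralIntegral.add (hE : IsSpectralMeasure E) (hf : HasSpectralIntegral E f A)
    (hg : HasSpectralIntegral E g B) : HasSpectralIntegral E (fun z => f z + g z) (A + B) := by
  obtain ⟨s, hs, hs'⟩ := hf
  obtain ⟨t, ht, ht'⟩ := hg
  refine ⟨fun n => s n + t n, hs.add ht, ?_⟩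
  simpa only [simpleIntegral_add hE] using hs'.add ht'

theorem HasSpectralIntegral.mul (hE : IsSpectralMeasure E) (hf : HasSpectralIntegral E f A)
    (hg : HasSpectralIntegral E g B) : HasSpectralIntegral E (fun z => f z * g z) (A * B) := by
  obtain ⟨C, hC0, hC⟩ := hf.exists_norm_le
  obtain ⟨D, hD0, hD⟩ := hg.exists_norm_le
  obtain ⟨s, hs, hs'⟩ := hf
  obtain ⟨t, ht, ht'⟩ := hg
  refine ⟨fun n => s n * t n, hs.mul_of_bounded ht (hC0.trans (le_max_left C D))
    (fun x => (hC x).trans (le_max_left _ _)) (fun x => (hD x).trans (le_max_right _ _)), ?_⟩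
  simpa only [simpleIntegral_mul hE] using hs'.mul ht'

theorem HasSpectralIntegral.smul (hE : IsSpectralMeasure E) (hf : HasSpectralIntegral E f A)
    (c : ℂ) : HasSpectralIntegral E (fun z => c * f z) (c • A) := by
  simpa using (HasSpectralIntegral.const hE c).mul hE hf

theorem HasSpectralIntegral.sub (hE : IsSpectralMeasure E) (hf : HasSpectralIntegral E f A)
    (hg : HasSpectralIntegral E g B) : HasSpectralIntegral E (fun z => f z - g z) (A - B) := by
  simpa [sub_eq_add_neg] using hf.add hE (hg.smul hE (-1))

theorem HasSpectralIntegral.norm_le (hE : IsSpectralMeasure E) {M : ℝ} (hM0 : 0 ≤ M)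
    (hM : ∀ s, MeasurableSet s → ‖E s‖ ≤ M) (hf : HasSpectralIntegral E f A) {C : ℝ} (hC0 : 0 ≤ C)
    (hC : ∀ z, ‖f z‖ ≤ C) : ‖A‖ ≤ 4 * M * C := by
  obtain ⟨s, hs, hs'⟩ := hf
  have key : ∀ ε : ℝ, 0 < ε → ‖A‖ ≤ 4 * M * (C + ε) := by
    intro ε hε
    refine le_of_tendsto hs'.norm ?_
    filter_upwards [Metric.tendstoUniformly_iff.mp hs ε hε] with n hn
    refine norm_simpleIntegral_le hE hM0 hM (s n) (by positivity) fun z => ?_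
    have h1 := hn z
    rw [dist_comm, dist_eq_norm] at h1
    calc ‖s n z‖ = ‖f z + (s n z - f z)‖ := by rw [add_sub_cancel]
      _ ≤ _ := norm_add_le _ _
      _ ≤ C + ε := add_le_add (hC z) h1.le
  have hlim : Tendsto (fun ε : ℝ => 4 * M * (C + ε)) (𝓝[>] 0) (𝓝 (4 * M * C)) := by
    have : Continuous fun ε : ℝ => 4 * M * (C + ε) := by fun_prop
    simpa using (this.tendsto 0).mono_left nhdsWithin_le_nhds
  exact ge_of_tendsto hlim (by filter_upwards [self_mem_nhdsWithin] with ε hε using key ε hε)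

variable [CompleteSpace G]

/-- The norm bound applied to the zero function shows that the limit does not depend on the
approximating sequence, so the choice in `spectralIntegral` is harmless. -/
theorem HasSpectralIntegral.unique (hE : IsSpectralMeasure E) (hf : HasSpectralIntegral E f A)
    (hf' : HasSpectralIntegral E f B) : A = B := by
  obtain ⟨M, hM0, hM⟩ := hE.exists_bound
  have := (hf.sub hE hf').norm_le hE hM0 hM le_rfl (fun z => by simp)
  rw [mul_zero] at this
  exact sub_eq_zero.mp (norm_le_zero_iff.mp this)

theorem HasSpectralIntegral.spectralIntegral_eq (hE : IsSpectralMeasure E)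
    (hf : HasSpectralIntegral E f A) : spectralIntegral E f = A := by
  have h : ∃ A, HasSpectralIntegral E f A := ⟨A, hf⟩
  rw [spectralIntegral, dif_pos h]
  exact h.choose_spec.unique hE hf

/-- Every bounded Borel function has an integral with respect to a spectral measure. -/
theorem hasSpectralIntegral_of_bounded (hE : IsSpectralMeasure E) (hf : Measurable f) {C : ℝ}
    (hC : ∀ z, ‖f z‖ ≤ C) : HasSpectralIntegral E f (spectralIntegral E f) := by
  obtain ⟨M, hM0, hM⟩ := hE.exists_bound
  suffices h : ∃ A, HasSpectralIntegral E f A by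
    obtain ⟨A, hA⟩ := h
    rwa [hA.spectralIntegral_eq hE]
  have hpos : ∀ n : ℕ, (0 : ℝ) < 1 / ((n : ℝ) + 1) := fun n => by positivity
  choose s hs using fun n : ℕ => SimpleFunc.exists_dist_lt hf hC (hpos n)
  have hcau : CauchySeq fun n => simpleIntegral E (s n) := by
    refine cauchySeq_of_le_tendsto_0 (fun N : ℕ => 4 * M * (2 * (1 / ((N : ℝ) + 1)))) ?_ ?_
    · intro n m N hn hm
      rw [dist_eq_norm]
      refine ((HasSpectralIntegral.of_simpleFunc (s n)).sub hE (.of_simpleFunc (s m))).norm_le hE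
        hM0 hM (by positivity) fun z => ?_
      rw [← dist_eq_norm]
      have h1 := (hs n z).le.trans (one_div_le_one_div_of_le (by positivity)
        (by gcongr : (N : ℝ) + 1 ≤ n + 1))
      have h2 := (hs m z).le.trans (one_div_le_one_div_of_le (by positivity)
        (by gcongr : (N : ℝ) + 1 ≤ m + 1))
      linarith [dist_triangle_right (s n z) (s m z) (f z)]
    · simpa using (tendsto_one_div_add_atTop_nhds_zero_nat (𝕜 := ℝ)).const_mul 2 |>.const_mul (4 * M)
  obtain ⟨A, hA⟩ := cauchySeq_tendsto_of_complete hcau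
  refine ⟨A, s, Metric.tendstoUniformly_iff.mpr fun ε hε => ?_, hA⟩
  filter_upwards [(tendsto_one_div_add_atTop_nhds_zero_nat (𝕜 := ℝ)).eventually_lt_const hε]
    with n hn z
  rw [dist_comm]
  exact (hs n z).trans hn

/-- The integral only depends on the integrand almost everywhere. -/
theorem HasSpectralIntegral.congr_of_eqOn (hE : IsSpectralMeasure E)
    (hf : HasSpectralIntegral E f A) (hg : HasSpectralIntegral E g B) {s : Set ℂ}
    (hs : MeasurableSet s) (hs1 : E s = 1) (hfg : Set.EqOn f g s) : A = B := by
  have h1 := hf.mul hE (.indicator_one hE hs)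
  have h2 := hg.mul hE (.indicator_one hE hs)
  rw [hs1, mul_one] at h1 h2
  refine h1.unique hE ?_
  convert h2 using 2 with z
  by_cases hz : z ∈ s <;> simp [hz, hfg _]

end SpectralMeasure

/-! ### The support and its relation to the spectrum -/

namespace SpectralMeasure

variable {G : Type*} [NormedAddCommGroup G] [NormedSpace ℂ G] {E : Set ℂ → (G →L[ℂ] G)}

theorem isClosed_supp : IsClosed (supp E) :=
  isClosed_biInter fun _ _ => isClosed_closure

theorem supp_subset {C : Set ℂ} (hC : IsClosed C) (h1 : E C = 1) : supp E ⊆ C :=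
  fun _ hz => hC.closure_subset (Set.mem_iInter₂.mp hz C ⟨hC.measurableSet, h1⟩)

/-- The complement of the support is a union of open null sets; as ℂ is hereditarily Lindelöf,
countably many of them suffice. -/
theorem apply_supp (hE : IsSpectralMeasure E) : E (supp E) = 1 := by
  refine hE.eq_one_of_compl_eq_zero isClosed_supp.measurableSet ?_
  have hcompl : (supp E)ᶜ = ⋃ s ∈ {s : Set ℂ | MeasurableSet s ∧ E s = 1}, (closure s)ᶜ := by
    simp only [supp, Set.compl_iInter]
  obtain ⟨S, hS, hSc, hSU⟩ := TopologicalSpace.isOpen_biUnion_countable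
    {s : Set ℂ | MeasurableSet s ∧ E s = 1} (fun s => (closure s)ᶜ)
    (fun s _ => isClosed_closure.isOpen_compl)
  rw [hcompl, ← hSU]
  rcases S.eq_empty_or_nonempty with rfl | hne
  · simp [hE.empty]
  · obtain ⟨u, rfl⟩ := hSc.exists_eq_range hne
    rw [Set.biUnion_range]
    refine hE.iUnion_eq_zero (fun n => isClosed_closure.isOpen_compl.measurableSet) fun n => ?_
    obtain ⟨hm, h1⟩ := hS ⟨n, rfl⟩
    exact hE.compl_eq_zero isClosed_closure.measurableSet
      (hE.eq_one_of_subset hm isClosed_closure.measurableSet subset_closure h1)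

theorem calculus_eq_everywhere_iff {f : ℂ → ℂ} {A : G →L[ℂ] G} :
    calculus E f = A.everywhere ↔
      ∀ x, Tendsto (fun n => spectralIntegral E (trunc E f n) x) atTop (𝓝 (A x)) := by
  constructor
  · intro h x
    have hx : x ∈ (calculus E f).domain := by rw [h]; trivial
    have h1 : Tendsto (fun n => spectralIntegral E (trunc E f n) x) atTop
        (𝓝 (calculus E f ⟨x, hx⟩)) := hx.choose_spec
    have hx' : x ∈ A.everywhere.domain := trivial
    have h2 : calculus E f ⟨x, hx⟩ = A.everywhere ⟨x, hx'⟩ := @(LinearPMap.ext_iff.mp h).2 x _ _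
    change _ = A x at h2
    rwa [h2] at h1
  · intro h
    refine LinearPMap.ext ?_ ?_
    · ext x
      exact ⟨fun _ => trivial, fun _ => ⟨A x, h x⟩⟩
    · intro x hx hx'
      have hx1 : x ∈ (calculus E f).domain := hx
      exact tendsto_nhds_unique hx1.choose_spec (h x)

variable [CompleteSpace G]

/-- The calculus at a function that is bounded and Borel on a closed set of full measure. -/
theorem calculus_eq_of_bounded (hE : IsSpectralMeasure E) {C : Set ℂ} (hC : IsClosed C)
    (h1 : E C = 1) {f : ℂ → ℂ} (hf : Measurable (C.indicator f)) {b : ℝ}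
    (hb : ∀ z ∈ C, ‖f z‖ ≤ b) :
    calculus E f = (spectralIntegral E (C.indicator f)).everywhere := by
  refine calculus_eq_everywhere_iff.mpr fun x => ?_
  refine tendsto_const_nhds.congr' ?_
  obtain ⟨N, hN⟩ := exists_nat_ge b
  filter_upwards [eventually_ge_atTop N] with n hn
  have hsub := supp_subset hC h1
  -- Once n exceeds the bound b, truncation only restricts f to the support, so the sequence is
  -- eventually constant.
  have htr : trunc E f n = (supp E).indicator (C.indicator f) := by
    rw [Set.indicator_indicator, Set.inter_eq_left.mpr hsub, trunc]
    congr 1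
    refine Set.inter_eq_left.mpr fun z hz => ?_
    exact (hb z (hsub hz)).trans (hN.trans (by exact_mod_cast hn))
  have hbC : ∀ z, ‖C.indicator f z‖ ≤ max b 0 := fun z => by
    by_cases hz : z ∈ C
    · simpa [hz] using Or.inl (hb z hz)
    · simp [hz]
  rw [htr]
  congr 1
  refine (hasSpectralIntegral_of_bounded hE hf hbC).congr_of_eqOn hE
    (hasSpectralIntegral_of_bounded hE (hf.indicator isClosed_supp.measurableSet)
      (fun z => (norm_indicator_le_norm_self _ _).trans (hbC z)))
    isClosed_supp.measurableSet (apply_supp hE) fun z hz => ?_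
  rw [Set.indicator_of_mem hz]

/-- The support of a resolution of the identity of a bounded operator lies in its spectrum. -/
theorem IsResolution.supp_subset_spectrum {T : G →L[ℂ] G} (h : IsResolution T.everywhere E) :
    supp E ⊆ spectrum ℂ T := by
  obtain ⟨hE, hT⟩ := h
  have hlim := calculus_eq_everywhere_iff.mp hT.symm
  obtain ⟨M, hM0, hM⟩ := hE.exists_bound
  intro l hl
  by_contra hls
  obtain ⟨R, hR⟩ : ∃ R : G →L[ℂ] G, R * (algebraMap ℂ (G →L[ℂ] G) l - T) = 1 := by
    obtain ⟨u, hu⟩ := spectrum.notMem_iff.mp hls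
    exact ⟨↑u⁻¹, by rw [← hu]; exact u.inv_mul⟩
  -- On the range of the projection of a ball of radius ε at l, `T - l` has norm at most `4 * M *
  -- ε`, while the left inverse R bounds `l - T` from below. For this ε the projection must vanish,
  -- so l is not in the support.
  obtain ⟨ε, hε, hε1⟩ : ∃ ε : ℝ, 0 < ε ∧ ‖R‖ * (4 * M * ε) < 1 := by
    refine ⟨1 / (‖R‖ * (4 * M) + 1), by positivity, ?_⟩
    rw [← mul_assoc, mul_one_div, div_lt_one (by positivity)]
    linarith
  have hD : MeasurableSet (supp E ∩ Metric.ball l ε) :=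
    isClosed_supp.measurableSet.inter measurableSet_ball
  have hsmall : ∀ x, ‖(T - algebraMap ℂ (G →L[ℂ] G) l) (E (supp E ∩ Metric.ball l ε) x)‖
      ≤ 4 * M * ε * ‖x‖ := by
    intro x
    have ht := (hlim (E (supp E ∩ Metric.ball l ε) x)).sub_const
      (l • E (supp E ∩ Metric.ball l ε) x)
    have : (T - algebraMap ℂ (G →L[ℂ] G) l) (E (supp E ∩ Metric.ball l ε) x)
        = T (E (supp E ∩ Metric.ball l ε) x) - l • E (supp E ∩ Metric.ball l ε) x := by
      simp [Algebra.algebraMap_eq_smul_one]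
    rw [this]
    refine le_of_tendsto ht.norm ?_
    obtain ⟨N, hN⟩ := exists_nat_ge (‖l‖ + ε)
    filter_upwards [eventually_ge_atTop N] with n hn
    have hm : Measurable (trunc E (fun z => z) n) := measurable_id.indicator
      (isClosed_supp.measurableSet.inter (measurableSet_le measurable_norm measurable_const))
    have hI := hasSpectralIntegral_of_bounded hE hm (C := n) fun z => by
      by_cases hz : z ∈ supp E ∩ {z | ‖z‖ ≤ n}
      · rw [trunc, Set.indicator_of_mem hz]
        exact hz.2
      · rw [trunc, Set.indicator_of_notMem hz]
        simp
    have hI2 := (hI.sub hE (.const hE l)).mul hE (.indicator_one hE hD)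
    have hle := hI2.norm_le hE hM0 hM hε.le fun z => by
      by_cases hz : z ∈ supp E ∩ Metric.ball l ε
      · have hzn : z ∈ supp E ∩ {z | ‖z‖ ≤ n} := by
          refine ⟨hz.1, ?_⟩
          have h1 : ‖z - l‖ < ε := by rw [← dist_eq_norm]; exact hz.2
          have h2 : (N : ℝ) ≤ n := by exact_mod_cast hn
          have h3 : ‖z‖ ≤ ‖z - l‖ + ‖l‖ := by simpa using norm_add_le (z - l) l
          change ‖z‖ ≤ n
          linarith
        rw [trunc, Set.indicator_of_mem hzn, Set.indicator_of_mem hz, mul_one, ← dist_eq_norm]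
        exact (Metric.mem_ball.mp hz.2).le
      · rw [Set.indicator_of_notMem hz]
        simpa using hε.le
    have := ContinuousLinearMap.le_of_opNorm_le _ hle x
    simpa using this
  have hz : E (supp E ∩ Metric.ball l ε) = 0 := by
    ext x
    have hidem : E (supp E ∩ Metric.ball l ε) (E (supp E ∩ Metric.ball l ε) x)
        = E (supp E ∩ Metric.ball l ε) x := congrArg (fun A : G →L[ℂ] G => A x) (hE.proj _ hD)
    set y := E (supp E ∩ Metric.ball l ε) x
    have h1 := hsmall y
    rw [hidem] at h1
    have h2 : ‖y‖ ≤ ‖R‖ * (4 * M * ε * ‖y‖) := by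
      calc ‖y‖ = ‖R ((algebraMap ℂ (G →L[ℂ] G) l - T) y)‖ := by
            rw [← mul_apply_eq_comp, hR, one_apply_eq_self]
        _ ≤ ‖R‖ * ‖(algebraMap ℂ (G →L[ℂ] G) l - T) y‖ := R.le_opNorm _
        _ = ‖R‖ * ‖(T - algebraMap ℂ (G →L[ℂ] G) l) y‖ := by
            rw [← neg_sub T, neg_apply, norm_neg]
        _ ≤ _ := by gcongr
    have h3 : ‖y‖ ≤ 0 := by nlinarith [norm_nonneg y]
    simpa using norm_le_zero_iff.mp h3
  have hball : E (Metric.ball l ε)ᶜ = 1 := by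
    rw [hE.compl measurableSet_ball, sub_eq_self]
    rwa [hE.inter _ _ isClosed_supp.measurableSet measurableSet_ball, apply_supp hE, one_mul] at hz
  exact supp_subset Metric.isOpen_ball.isClosed_compl hball hl (Metric.mem_ball_self hε)

theorem IsResolution.apply_spectrum {T : G →L[ℂ] G} (h : IsResolution T.everywhere E) :
    E (spectrum ℂ T) = 1 :=
  h.1.eq_one_of_subset isClosed_supp.measurableSet (spectrum.isClosed T).measurableSet
    h.supp_subset_spectrum (apply_supp h.1)

end SpectralMeasure

/-! ### Homomorphisms from `C(K, ℂ)` are determined by the identity function -/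

/-- A bounded algebra homomorphism from `C(X, ℂ)` to a Banach algebra is determined at `star g` by
its value at `g`. -/
theorem ContinuousMap.algHom_star_eq {X B : Type*} [TopologicalSpace X] [CompactSpace X]
    [NormedRing B] [NormedAlgebra ℂ B] [CompleteSpace B] {φ ψ : C(X, ℂ) →ₐ[ℂ] B}
    (hφ : Continuous φ) (hψ : Continuous ψ) {g : C(X, ℂ)} (h : φ g = ψ g) :
    φ (star g) = ψ (star g) := by
  let _ : NormedAlgebra ℚ B := .restrictScalars ℚ ℂ B
  have hexp : ∀ {χ : C(X, ℂ) →ₐ[ℂ] B}, Continuous χ → ∀ u, χ (NormedSpace.exp u)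
      = NormedSpace.exp (χ u) := fun hχ u => NormedSpace.map_exp _ hχ u
  have hbd : ∀ {χ : C(X, ℂ) →ₐ[ℂ] B}, Continuous χ → ∃ K, ∀ u, ‖χ u‖ ≤ K * ‖u‖ := fun {χ} hχ =>
    ⟨_, (⟨χ.toLinearMap, hχ⟩ : C(X, ℂ) →L[ℂ] B).le_opNorm⟩
  obtain ⟨K, hK⟩ := hbd hφ
  obtain ⟨K', hK'⟩ := hbd hψ
  -- The exponent has the form `w - star w` pointwise, hence is purely imaginary.
  have hunit : ∀ c : ℂ, ‖NormedSpace.exp (c • star g - star c • g)‖ ≤ 1 := by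
    intro c
    refine (ContinuousMap.norm_le _ zero_le_one).mpr fun x => ?_
    have h1 : (NormedSpace.exp (c • star g - star c • g)) x
        = NormedSpace.exp ((c • star g - star c • g) x) :=
      NormedSpace.map_exp (ContinuousMap.evalAlgHom ℂ ℂ x) (by exact continuous_eval_const x) _
    rw [h1, ← Complex.exp_eq_exp_ℂ, Complex.norm_exp]
    simp [mul_comm]
  -- The factors `exp (star c • φ g)` and `exp (-star c • ψ g)` cancel because φ and ψ agree at g.
  -- Thus the entire function on the left is bounded, so constant by Liouville, and its derivative
  -- `φ (star g) - ψ (star g)` at 0 vanishes.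
  have hF : ∀ c : ℂ, NormedSpace.exp (c • φ (star g)) * NormedSpace.exp (c • -ψ (star g))
      = φ (NormedSpace.exp (c • star g - star c • g))
        * ψ (NormedSpace.exp ((-c) • star g - star (-c) • g)) := by
    intro c
    have e1 : NormedSpace.exp (c • star g)
        = NormedSpace.exp (c • star g - star c • g) * NormedSpace.exp (star c • g) := by
      rw [← NormedSpace.exp_add, sub_add_cancel]
    have e2 : NormedSpace.exp ((-c) • star g) = NormedSpace.exp (star (-c) • g)
        * NormedSpace.exp ((-c) • star g - star (-c) • g) := by
      rw [← NormedSpace.exp_add, add_sub_cancel]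
    have e3 : φ (NormedSpace.exp (star c • g)) * ψ (NormedSpace.exp (star (-c) • g)) = 1 := by
      rw [hexp hφ, map_smul, h, ← map_smul, ← hexp hψ, ← map_mul, ← NormedSpace.exp_add,
        ← add_smul, ← star_add]
      simp
    rw [smul_neg, ← neg_smul, ← map_smul, ← map_smul, ← hexp hφ, ← hexp hψ, e1, e2, map_mul, map_mul,
      mul_assoc, ← mul_assoc _ _ (ψ (NormedSpace.exp ((-c) • star g - star (-c) • g))), e3, one_mul]
  have hder : ∀ c, HasDerivAt
      (fun c : ℂ => NormedSpace.exp (c • φ (star g)) * NormedSpace.exp (c • -ψ (star g))) _ c :=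
    fun c => (hasDerivAt_exp_smul_const (φ (star g)) c).mul
      (hasDerivAt_exp_smul_const (-ψ (star g)) c)
  have hconst := Differentiable.apply_eq_apply_of_bounded
    (f := fun c : ℂ => NormedSpace.exp (c • φ (star g)) * NormedSpace.exp (c • -ψ (star g)))
    (fun c => (hder c).differentiableAt) (by
      refine isBounded_iff_forall_norm_le.mpr ⟨|K| * |K'|, ?_⟩
      rintro _ ⟨c, rfl⟩
      simp only [hF]
      refine (norm_mul_le _ _).trans (mul_le_mul ?_ ?_ (norm_nonneg _) (abs_nonneg _))
      · exact (hK _).trans ((mul_le_mul (le_abs_self K) (hunit c) (norm_nonneg _)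
          (abs_nonneg _)).trans_eq (mul_one _))
      · exact (hK' _).trans ((mul_le_mul (le_abs_self K') (hunit (-c)) (norm_nonneg _)
          (abs_nonneg _)).trans_eq (mul_one _)))
  have h0 := (hder 0).unique ((hasDerivAt_const (0 : ℂ) (1 : B)).congr_of_eventuallyEq
    (.of_forall fun c => (hconst c 0).trans (by simp)))
  simp only [zero_smul, NormedSpace.exp_zero, mul_one, one_mul] at h0
  exact add_neg_eq_zero.mp h0

theorem ContinuousMap.algHom_ext_of_apply_id {B : Type*}
    [NormedRing B] [NormedAlgebra ℂ B] [CompleteSpace B] {s : Set ℂ} [CompactSpace s]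
    {φ ψ : C(s, ℂ) →ₐ[ℂ] B} (hφ : Continuous φ) (hψ : Continuous ψ)
    (h : φ (.restrict s (.id ℂ)) = ψ (.restrict s (.id ℂ))) : φ = ψ := by
  ext f
  induction f using ContinuousMap.induction_on_of_compact with
  | const r => exact (φ.commutes r).trans (ψ.commutes r).symm
  | id => exact h
  | star_id => exact ContinuousMap.algHom_star_eq hφ hψ h
  | add f g hf hg => rw [map_add, map_add, hf, hg]
  | mul f g hf hg => rw [map_mul, map_mul, hf, hg]
  | frequently f hf => exact hf.mem_of_closed (isClosed_eq hφ hψ)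

/-! ### The continuous calculus and its independence of the resolution -/

namespace SpectralMeasure

variable {G : Type*} [NormedAddCommGroup G] [NormedSpace ℂ G] [CompleteSpace G]
  {E : Set ℂ → (G →L[ℂ] G)}

theorem hasSpectralIntegral_extend (hE : IsSpectralMeasure E) {C : Set ℂ} (hC : IsClosed C)
    [CompactSpace C] (f : C(C, ℂ)) :
    HasSpectralIntegral E (Function.extend Subtype.val f 0)
      (spectralIntegral E (Function.extend Subtype.val f 0)) := by
  refine hasSpectralIntegral_of_bounded hE (C := ‖f‖)
    ((MeasurableEmbedding.subtype_coe hC.measurableSet).measurable_extend f.continuous.measurable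
      measurable_const) fun z => ?_
  by_cases hz : z ∈ C
  · rw [Subtype.val_injective.extend_apply f 0 ⟨z, hz⟩]
    exact f.norm_coe_le_norm _
  · rw [Function.extend_apply' _ _ _ (by simpa using hz)]
    simp

/-- The integral of continuous functions on a compact set of full measure. -/
noncomputable def continuousCalculus (hE : IsSpectralMeasure E) {C : Set ℂ} (hC : IsClosed C)
    [CompactSpace C] (h1 : E C = 1) : C(C, ℂ) →ₐ[ℂ] (G →L[ℂ] G) := by
  have hext : ∀ (f : C(C, ℂ)) (z : C), Function.extend Subtype.val f 0 z.1 = f z := fun f z =>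
    Subtype.val_injective.extend_apply _ _ _
  -- The algebraic identities need only be checked on C, which has full measure; off C the one for
  -- the unit fails, since 1 is extended by 0.
  exact AlgHom.ofLinearMap
    { toFun := fun f => spectralIntegral E (Function.extend Subtype.val f 0)
      map_add' := fun f g => (hasSpectralIntegral_extend hE hC (f + g)).congr_of_eqOn hE
        ((hasSpectralIntegral_extend hE hC f).add hE (hasSpectralIntegral_extend hE hC g))
        hC.measurableSet h1 fun z hz => by
          simp only [hext _ ⟨z, hz⟩, ContinuousMap.add_apply]
      map_smul' := fun c f => (hasSpectralIntegral_extend hE hC (c • f)).congr_of_eqOn hE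
        ((hasSpectralIntegral_extend hE hC f).smul hE c)
        hC.measurableSet h1 fun z hz => by
          simp only [hext _ ⟨z, hz⟩, ContinuousMap.smul_apply, smul_eq_mul] }
    ((hasSpectralIntegral_extend hE hC 1).congr_of_eqOn hE
      (one_smul ℂ (1 : G →L[ℂ] G) ▸ HasSpectralIntegral.const hE 1) hC.measurableSet h1 fun z hz =>
        hext _ ⟨z, hz⟩)
    fun f g => (hasSpectralIntegral_extend hE hC (f * g)).congr_of_eqOn hE
        ((hasSpectralIntegral_extend hE hC f).mul hE (hasSpectralIntegral_extend hE hC g))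
        hC.measurableSet h1 fun z hz => by
          simp only [hext _ ⟨z, hz⟩, ContinuousMap.mul_apply]

theorem continuousCalculus_apply (hE : IsSpectralMeasure E) {C : Set ℂ} (hC : IsClosed C)
    [CompactSpace C] (h1 : E C = 1) (f : C(C, ℂ)) :
    continuousCalculus hE hC h1 f = spectralIntegral E (Function.extend Subtype.val f 0) :=
  rfl

theorem continuous_continuousCalculus (hE : IsSpectralMeasure E) {C : Set ℂ} (hC : IsClosed C)
    [CompactSpace C] (h1 : E C = 1) : Continuous (continuousCalculus hE hC h1) := by
  obtain ⟨M, hM0, hM⟩ := hE.exists_bound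
  refine AddMonoidHomClass.continuous_of_bound _ (4 * M) fun f => ?_
  refine (hasSpectralIntegral_extend hE hC f).norm_le hE hM0 hM (norm_nonneg _) fun z => ?_
  by_cases hz : z ∈ C
  · rw [Subtype.val_injective.extend_apply f 0 ⟨z, hz⟩]
    exact f.norm_coe_le_norm _
  · rw [Function.extend_apply' _ _ _ (by simpa using hz)]
    simp

/-- The Borel calculus at a function that is continuous on a compact set of full measure. -/
theorem calculus_eq_continuousCalculus (hE : IsSpectralMeasure E) {C : Set ℂ} (hC : IsClosed C)
    [CompactSpace C] (h1 : E C = 1) {f : ℂ → ℂ} (g : C(C, ℂ)) (hfg : ∀ z : C, g z = f z) :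
    calculus E f = (continuousCalculus hE hC h1 g).everywhere := by
  have hext : Function.extend Subtype.val g 0 = C.indicator f := by
    ext z
    by_cases hz : z ∈ C
    · rw [Subtype.val_injective.extend_apply g 0 ⟨z, hz⟩, Set.indicator_of_mem hz, hfg]
    · rw [Function.extend_apply' _ _ _ (by simpa using hz), Set.indicator_of_notMem hz]
      rfl
  rw [continuousCalculus_apply, hext]
  refine calculus_eq_of_bounded hE hC h1 ?_ (b := ‖g‖) fun z hz => ?_
  · rw [← hext]
    exact (MeasurableEmbedding.subtype_coe hC.measurableSet).measurable_extend
      g.continuous.measurable measurable_const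
  · rw [← hfg ⟨z, hz⟩]
    exact g.norm_coe_le_norm _

end SpectralMeasure

theorem ContinuousLinearMap.everywhere_injective {G : Type*} [NormedAddCommGroup G]
    [NormedSpace ℂ G] :
    Function.Injective (ContinuousLinearMap.everywhere : (G →L[ℂ] G) → (G →ₗ.[ℂ] G)) := by
  intro A B h
  ext x
  have hA : x ∈ A.everywhere.domain := trivial
  have hB : x ∈ B.everywhere.domain := trivial
  have : A.everywhere ⟨x, hA⟩ = B.everywhere ⟨x, hB⟩ := @(LinearPMap.ext_iff.mp h).2 x _ _
  exact this

namespace SpectralMeasure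

variable {G : Type*} [NormedAddCommGroup G] [NormedSpace ℂ G] [CompleteSpace G]
  {E E' : Set ℂ → (G →L[ℂ] G)}

theorem IsResolution.continuousCalculus_id {T : G →L[ℂ] G} (h : IsResolution T.everywhere E)
    {C : Set ℂ} (hC : IsClosed C) [CompactSpace C] (h1 : E C = 1) :
    continuousCalculus h.1 hC h1 (.restrict C (.id ℂ)) = T :=
  ContinuousLinearMap.everywhere_injective <|
    (calculus_eq_continuousCalculus h.1 hC h1 _ fun _ => rfl).symm.trans h.2.symm

/-- Two resolutions of the identity of a bounded operator define the same calculus for functions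
that are continuous on the spectrum. -/
theorem IsResolution.calculus_eq {T : G →L[ℂ] G} (h : IsResolution T.everywhere E)
    (h' : IsResolution T.everywhere E') {f : ℂ → ℂ} (hf : ContinuousOn f (spectrum ℂ T)) :
    calculus E f = calculus E' f := by
  have hc : CompactSpace (spectrum ℂ T) := isCompact_iff_compactSpace.mp (spectrum.isCompact T)
  have hcl := spectrum.isClosed (𝕜 := ℂ) T
  let g : C(spectrum ℂ T, ℂ) := ⟨(spectrum ℂ T).domRestrict f, hf.domRestrict⟩
  rw [calculus_eq_continuousCalculus h.1 hcl h.apply_spectrum g fun _ => rfl,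
    calculus_eq_continuousCalculus h'.1 hcl h'.apply_spectrum g fun _ => rfl,
    ContinuousMap.algHom_ext_of_apply_id (continuous_continuousCalculus h.1 hcl h.apply_spectrum)
      (continuous_continuousCalculus h'.1 hcl h'.apply_spectrum)
      ((h.continuousCalculus_id hcl _).trans (h'.continuousCalculus_id hcl _).symm)]

/-- `borelCalculus` picks some resolution of the identity; this permits replacing it by any
convenient one. -/
theorem _root_.borelCalculus_eq_calculus {T : G →L[ℂ] G} (h : IsResolution T.everywhere E)
    {f : ℂ → ℂ} (hf : ContinuousOn f (spectrum ℂ T)) :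
    borelCalculus T.everywhere f = calculus E f := by
  have hT : IsScalarTypeSpectral T.everywhere := ⟨E, h⟩
  rw [borelCalculus, dif_pos hT]
  exact IsResolution.calculus_eq hT.choose_spec h hf

end SpectralMeasure

/-! ### Image measures and change of variables -/

/-- The image of a spectral measure under a Borel map of the plane. -/
theorem IsSpectralMeasure.map {G : Type*} [NormedAddCommGroup G] [NormedSpace ℂ G]
    {E : Set ℂ → (G →L[ℂ] G)} (hE : IsSpectralMeasure E) {h : ℂ → ℂ} (hh : Measurable h) :
    IsSpectralMeasure (fun s => E (h ⁻¹' s)) where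
  proj s hs := hE.proj _ (hh hs)
  inter s t hs ht := hE.inter _ _ (hh hs) (hh ht)
  union s t hs ht := hE.union _ _ (hh hs) (hh ht)
  univ := hE.univ
  empty := hE.empty
  weak_countably_additive s hs hd x φ := by
    simpa only [Set.preimage_iUnion] using hE.weak_countably_additive (fun n => h ⁻¹' s n)
      (fun n => hh (hs n)) (fun m n hmn => (hd hmn).preimage h) x φ

namespace SpectralMeasure

variable {G : Type*} [NormedAddCommGroup G] [NormedSpace ℂ G]
  {E : Set ℂ → (G →L[ℂ] G)}

theorem simpleIntegral_preimage (hE : IsSpectralMeasure E) {h : ℂ → ℂ} (hh : Measurable h)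
    (s : SimpleFunc ℂ ℂ) :
    simpleIntegral (fun u => E (h ⁻¹' u)) s = simpleIntegral E (s.comp h hh) := by
  refine (Finset.sum_subset (SimpleFunc.range_comp_subset_range s hh) fun c _ hc => ?_).symm
  have : h ⁻¹' (s ⁻¹' {c}) = ∅ := by
    rw [← Set.preimage_comp, ← SimpleFunc.coe_comp s hh]
    exact (SimpleFunc.preimage_eq_empty_iff _ _).mpr hc
  simp only [this, hE.empty, smul_zero]

theorem HasSpectralIntegral.comp (hE : IsSpectralMeasure E) {h : ℂ → ℂ} (hh : Measurable h)
    {f : ℂ → ℂ} {A : G →L[ℂ] G} (hf : HasSpectralIntegral (fun u => E (h ⁻¹' u)) f A) :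
    HasSpectralIntegral E (f ∘ h) A := by
  obtain ⟨s, hs, hs'⟩ := hf
  refine ⟨fun n => (s n).comp h hh, hs.comp h, ?_⟩
  simpa only [simpleIntegral_preimage hE hh] using hs'

variable [CompleteSpace G]

/-- Change of variables in the Borel calculus. -/
theorem calculus_preimage (hE : IsSpectralMeasure E) {C : Set ℂ} (hC : IsCompact C) (h1 : E C = 1)
    {h : ℂ → ℂ} (hh : Continuous h) {f : ℂ → ℂ} (hf : ContinuousOn f (h '' C)) :
    calculus (fun u => E (h ⁻¹' u)) f = calculus E (f ∘ h) := by
  have hCh : IsCompact (h '' C) := hC.image hh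
  have : CompactSpace C := isCompact_iff_compactSpace.mp hC
  have : CompactSpace (h '' C) := isCompact_iff_compactSpace.mp hCh
  have hE' := hE.map hh.measurable
  have h1' : E (h ⁻¹' (h '' C)) = 1 := hE.eq_one_of_subset hC.isClosed.measurableSet
    (hh.measurable hCh.isClosed.measurableSet) (Set.subset_preimage_image h C) h1
  let g' : C(h '' C, ℂ) := ⟨(h '' C).domRestrict f, hf.domRestrict⟩
  let g : C(C, ℂ) := ⟨C.domRestrict (f ∘ h),
    (hf.comp hh.continuousOn (Set.mapsTo_image h C)).domRestrict⟩
  rw [calculus_eq_continuousCalculus hE' hCh.isClosed h1' g' fun _ => rfl,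
    calculus_eq_continuousCalculus hE hC.isClosed h1 g fun _ => rfl]
  congr 1
  refine ((hasSpectralIntegral_extend hE' hCh.isClosed g').comp hE hh.measurable).congr_of_eqOn hE
    (hasSpectralIntegral_extend hE hC.isClosed g) hC.isClosed.measurableSet h1 fun z hz => ?_
  have e1 : Function.extend Subtype.val g' 0 (h z) = f (h z) :=
    Subtype.val_injective.extend_apply g' 0 ⟨h z, Set.mem_image_of_mem h hz⟩
  have e2 : Function.extend Subtype.val g 0 z = f (h z) :=
    Subtype.val_injective.extend_apply g 0 ⟨z, hz⟩
  rw [Function.comp_apply, e1, e2]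

/-- The image of a resolution of the identity of `T` under multiplication by `c` is a resolution
of the identity of `c • T`. -/
theorem IsResolution.smul {T : G →L[ℂ] G} (h : IsResolution T.everywhere E) (c : ℂ) :
    IsResolution (c • T).everywhere (fun u => E ((fun z => c * z) ⁻¹' u)) := by
  have hcont : Continuous fun z : ℂ => c * z := by fun_prop
  have hcl := spectrum.isClosed (𝕜 := ℂ) T
  have : CompactSpace (spectrum ℂ T) := isCompact_iff_compactSpace.mp (spectrum.isCompact T)
  refine ⟨h.1.map hcont.measurable, ?_⟩
  rw [calculus_preimage h.1 (spectrum.isCompact T) h.apply_spectrum hcont (continuousOn_id' _),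
    calculus_eq_continuousCalculus h.1 hcl h.apply_spectrum (c • .restrict _ (.id ℂ))
      (fun _ => rfl), map_smul, h.continuousCalculus_id]

end SpectralMeasure

/-! ### Dilations of functions on a compact set -/

/-- The dilations `z ↦ f (t * z)` of a continuous function depend continuously on `t`, uniformly on
compact sets. -/
theorem exists_continuousOn_dilation {K U : Set ℂ} [CompactSpace K] {I : Set ℝ}
    (h : ∀ t ∈ I, ∀ z ∈ K, (t : ℂ) * z ∈ U) {f : ℂ → ℂ} (hf : ContinuousOn f U) :
    ∃ k : ℝ → C(K, ℂ), ContinuousOn k I ∧ ∀ t ∈ I, ∀ z : K, k t z = f (t * z) := by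
  classical
  -- Currying a jointly continuous function gives a map continuous for the compact-open topology,
  -- which is the norm topology as K is compact. Off I the value 0 is a dummy.
  let c : C(I × K, ℂ) := ⟨fun p => f ((p.1 : ℝ) * (p.2 : ℂ)),
    hf.comp_continuous (by fun_prop) fun p => h p.1 p.1.2 p.2 p.2.2⟩
  refine ⟨fun t => if ht : t ∈ I then c.curry ⟨t, ht⟩ else 0, ?_, fun t ht z => ?_⟩
  · rw [continuousOn_iff_continuous_domRestrict]
    convert c.curry.continuous using 1
    ext t : 1
    simp
  · simp only [ht, dif_pos]
    rfl

/-- Evaluation at z is a continuous linear map, so it commutes with the integral and reduces the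
claim to t ↦ F(tz), whose derivative is zF'(tz). -/
theorem integral_dilation_deriv {K U : Set ℂ} [CompactSpace K] {I : Set ℝ}
    (hI : I.OrdConnected) (h : ∀ t ∈ I, ∀ z ∈ K, (t : ℂ) * z ∈ U) {F : ℂ → ℂ}
    (hF : AnalyticOnNhd ℂ F U) {p q : ℝ → C(K, ℂ)} (hq : ContinuousOn q I)
    (hpF : ∀ t ∈ I, ∀ z : K, p t z = F (t * z)) (hqF : ∀ t ∈ I, ∀ z : K, q t z = deriv F (t * z))
    {u₁ u₂ : ℝ} (h₁ : u₁ ∈ I) (h₂ : u₂ ∈ I) :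
    ∫ t in u₁..u₂, (ContinuousMap.restrict K (.id ℂ)) * q t = p u₂ - p u₁ := by
  have hsub : Set.uIcc u₁ u₂ ⊆ I := hI.uIcc_subset h₁ h₂
  have hcont : ContinuousOn (fun t => (ContinuousMap.restrict K (.id ℂ)) * q t)
      (Set.uIcc u₁ u₂) := continuousOn_const.mul (hq.mono hsub)
  ext z
  have h1 := (ContinuousMap.evalCLM ℂ z).intervalIntegral_comp_comm
    (hcont.intervalIntegrable (μ := volume))
  change _ = (∫ t in u₁..u₂, (ContinuousMap.restrict K (.id ℂ)) * q t) z at h1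
  rw [← h1, ContinuousMap.sub_apply, hpF _ h₁, hpF _ h₂]
  refine intervalIntegral.integral_eq_sub_of_hasDerivAt (f := fun t : ℝ => F (t * z))
    (fun t ht => ?_) ((ContinuousMap.evalCLM ℂ z).continuous.comp_continuousOn
      hcont).intervalIntegrable
  have h2 := (hF _ (h t (hsub ht) z z.2)).differentiableAt.hasDerivAt
  have h3 : HasDerivAt (fun t : ℝ => (t : ℂ) * (z : ℂ)) (1 * z) t :=
    (Complex.ofRealCLM.hasDerivAt (x := t)).mul_const _
  have h4 : deriv F (t * z) * (1 * z)
      = ContinuousMap.evalCLM ℂ z (ContinuousMap.restrict K (.id ℂ) * q t) := by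
    change _ = (z : ℂ) * q t z
    rw [hqF t (hsub ht), one_mul, mul_comm]
  rw [← h4]
  exact h2.comp t h3

theorem spectrum_smul_subset {B : Type*} [NormedRing B] [NormedAlgebra ℂ B] [CompleteSpace B]
    (a : B) (c : ℂ) : spectrum ℂ (c • a) ⊆ (fun z => c * z) '' spectrum ℂ a := by
  -- The scaling law for spectra needs a nonempty spectrum, in particular at c = 0; in the zero
  -- algebra the spectrum is empty.
  rcases subsingleton_or_nontrivial B with hB | hB
  · simp
  · rw [spectrum.smul_eq_smul c a (spectrum.nonempty a)]
    rfl

/-! ### The main theorem -/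

open SpectralMeasure in
/-- `Φ t` is the bounded operator `F(tT)` and `Ψ t` the bounded operator `F'(tT)`, both formed by
the Borel functional calculus of the operator `tT`. -/
theorem theorem19500603 {G : Type*} [NormedAddCommGroup G] [NormedSpace ℂ G] [CompleteSpace G]
    (T : G →L[ℂ] G) (hT : IsScalarTypeSpectral T.everywhere)
    (L : EReal) (hL : 0 < L)
    (U : Set ℂ) (hU : IsOpen U) (hTU : spectrum ℂ T ⊆ U)
    (hLU : ∀ t : ℝ, -L < (t : EReal) → (t : EReal) < L → ∀ z ∈ U, (t : ℂ) * z ∈ U)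
    (F : ℂ → ℂ) (hF : AnalyticOnNhd ℂ F U) :
    ∃ Φ Ψ : ℝ → (G →L[ℂ] G),
      (∀ t : ℝ, -L < (t : EReal) → (t : EReal) < L →
        (IsScalarTypeSpectral ((t : ℂ) • T).everywhere ∧ spectrum ℂ ((t : ℂ) • T) ⊆ U) ∧
        borelCalculus ((t : ℂ) • T).everywhere F = (Φ t).everywhere ∧
        borelCalculus ((t : ℂ) • T).everywhere (deriv F) = (Ψ t).everywhere ∧
        borelCalculus ((t : ℂ) • T).everywhere F
          = borelCalculus T.everywhere (fun z => F ((t : ℂ) * z)) ∧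
        HasDerivAt Φ (T * Ψ t) t) ∧
      (∀ u₁ u₂ : ℝ, -L < (u₁ : EReal) → (u₁ : EReal) < L → -L < (u₂ : EReal) → (u₂ : EReal) < L →
        IntervalIntegrable Ψ volume u₁ u₂ ∧
        T * (∫ t in u₁..u₂, Ψ t) = Φ u₂ - Φ u₁) := by
  obtain ⟨E, hE⟩ := hT
  let I : Set ℝ := {t : ℝ | -L < (t : EReal) ∧ (t : EReal) < L}
  have hIopen : IsOpen I := (isOpen_Ioo (a := -L) (b := L)).preimage continuous_coe_real_ereal
  have hIord : I.OrdConnected :=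
    (Set.ordConnected_Ioo (a := -L) (b := L)).preimage_mono EReal.coe_strictMono.monotone
  have hK : ∀ t ∈ I, ∀ z ∈ spectrum ℂ T, (t : ℂ) * z ∈ U := fun t ht z hz =>
    hLU t ht.1 ht.2 z (hTU hz)
  have hcomp := spectrum.isCompact (𝕜 := ℂ) T
  have hcl := hcomp.isClosed
  have : CompactSpace (spectrum ℂ T) := isCompact_iff_compactSpace.mp hcomp
  have hF' : ContinuousOn (deriv F) U := hF.deriv.continuousOn
  obtain ⟨p, -, hpF⟩ := exists_continuousOn_dilation hK hF.continuousOn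
  obtain ⟨q, hq, hqF⟩ := exists_continuousOn_dilation hK hF'
  -- The calculus of T as a bounded linear map, so that it commutes with integrals of continuous
  -- curves.
  let A : C(spectrum ℂ T, ℂ) →L[ℂ] (G →L[ℂ] G) :=
    ⟨(continuousCalculus hE.1 hcl hE.apply_spectrum).toLinearMap,
      continuous_continuousCalculus hE.1 hcl hE.apply_spectrum⟩
  have hAid : ∀ g, A (ContinuousMap.restrict _ (.id ℂ) * g) = T * A g := fun g =>
    (map_mul (continuousCalculus hE.1 hcl hE.apply_spectrum) _ g).trans
      (congrArg (· * A g) (hE.continuousCalculus_id hcl _))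
  have himage : ∀ t ∈ I, (fun z => (t : ℂ) * z) '' spectrum ℂ T ⊆ U := fun t ht => by
    rintro _ ⟨z, hz, rfl⟩
    exact hK t ht z hz
  have hspec : ∀ t ∈ I, spectrum ℂ ((t : ℂ) • T) ⊆ U := fun t ht =>
    (spectrum_smul_subset T t).trans (himage t ht)
  have hcalc : ∀ t ∈ I, ∀ f : ℂ → ℂ, ContinuousOn f U →
      borelCalculus ((t : ℂ) • T).everywhere f = calculus E (fun z => f ((t : ℂ) * z)) :=
    fun t ht f hf => (borelCalculus_eq_calculus (hE.smul t) (hf.mono (hspec t ht))).trans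
      (calculus_preimage hE.1 hcomp hE.apply_spectrum (by fun_prop) (hf.mono (himage t ht)))
  have hAq : ContinuousOn (fun t => A (q t)) I := A.continuous.comp_continuousOn hq
  have hint : ∀ {u₁ u₂ : ℝ}, u₁ ∈ I → u₂ ∈ I →
      IntervalIntegrable (fun t => A (q t)) volume u₁ u₂ := fun h₁ h₂ =>
    (hAq.mono (hIord.uIcc_subset h₁ h₂)).intervalIntegrable
  have hFTC : ∀ {u₁ u₂ : ℝ}, u₁ ∈ I → u₂ ∈ I →
      T * (∫ t in u₁..u₂, A (q t)) = A (p u₂) - A (p u₁) := by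
    intro u₁ u₂ h₁ h₂
    have hqi : IntervalIntegrable (fun t => ContinuousMap.restrict (spectrum ℂ T) (.id ℂ) * q t)
        volume u₁ u₂ :=
      (continuousOn_const.mul (hq.mono (hIord.uIcc_subset h₁ h₂))).intervalIntegrable
    rw [← map_sub, ← integral_dilation_deriv hIord hK hF hq hpF hqF h₁ h₂,
      ← A.intervalIntegral_comp_comm hqi]
    simp only [hAid]
    exact ((ContinuousLinearMap.mul ℂ (G →L[ℂ] G) T).intervalIntegral_comp_comm (hint h₁ h₂)).symm
  refine ⟨fun t => A (p t), fun t => A (q t), fun t ht₁ ht₂ => ?_, fun u₁ u₂ h₁ h₁' h₂ h₂' =>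
    ⟨hint ⟨h₁, h₁'⟩ ⟨h₂, h₂'⟩, hFTC ⟨h₁, h₁'⟩ ⟨h₂, h₂'⟩⟩⟩
  have ht : t ∈ I := ⟨ht₁, ht₂⟩
  refine ⟨⟨⟨_, hE.smul t⟩, hspec t ht⟩, ?_, ?_, ?_, ?_⟩
  · rw [hcalc t ht F hF.continuousOn]
    exact calculus_eq_continuousCalculus hE.1 hcl hE.apply_spectrum (p t) (hpF t ht)
  · rw [hcalc t ht _ hF']
    exact calculus_eq_continuousCalculus hE.1 hcl hE.apply_spectrum (q t) (hqF t ht)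
  · rw [hcalc t ht F hF.continuousOn]
    exact (borelCalculus_eq_calculus hE
      (hF.continuousOn.comp (by fun_prop) fun z hz => hK t ht z hz)).symm
  -- With t itself as base point, `Φ s = T * ∫ r in t..s, Ψ r + Φ t` for s near t, and the integrand
  -- is norm continuous at t.
  · have hd := intervalIntegral.integral_hasDerivAt_right (hint ht ht)
      (hAq.stronglyMeasurableAtFilter hIopen t ht) (hAq.continuousAt (hIopen.mem_nhds ht))
    refine ((hd.const_mul T).add_const (A (p t))).congr_of_eventuallyEq ?_
    filter_upwards [hIopen.mem_nhds ht] with s hs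
    exact (sub_eq_iff_eq_add.mp (hFTC ht hs).symm)
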